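/- Let $\mathbb{K}$ be an algebraically closed field of characteristic $0$, let $A$ be a noetherian $\mathbb{K}$-algebra, $X=\operatorname{Spec}(A)$, and let $n,\mu\ge 0$ be integers. For a homogeneous ideal $I\subset A[x_0,\dots,x_n]$ and a prime $p\in \operatorname{Spec}(A)$ with residue field $k(p)=A_p/pA_p$, let $I(p)$ be the image of $I\otimes_A k(p)$ in $k(p)[x_0,\dots,x_n]$, and let $\overline{I(p)}$ be the ideal generated by $I(p)$ in $\overline{k(p)}[x_0,\dots,x_n]$, where $\overline{k(p)}$ is the algebraic closure of $k(p)$. Let $Z=\operatorname{Proj}(A[x_0,\dots,x_n]/I)$ be an element of $\mathbf{Hilb}^{\mu}_{\mathbb{P}^n}(X)$, that is, $I$ is a homogeneous ideal, the natural morphism $\pi:Z\to X$ is flat, and for every prime $q$ of $A$ the Hilbert polynomial of $k(q)[x_0,\dots,x_n]/I(q)$ is the constant $\mu$. Let $u\in\mathbb{K}[x_0,\dots,x_n]$ be a linear form (homogeneous of degree $1$, possibly zero), let $Z_u=D_+(u)\subset Z$ be the open subscheme on which $u$, as a section of $\mathcal{O}_Z(1)$, does not vanish, and let $\pi_*(\mathcal{O}_{Z_u})$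 be the direct image of $\mathcal{O}_{Z_u}$ under $\pi|_{Z_u}:Z_u\to X$. Let $p\in\operatorname{Spec}(A)$. For a homogeneous ideal $J$ of $S=\overline{k(p)}[x_0,\dots,x_n]$ whose Hilbert polynomial is constant, the set of points defined by $J$ is the set of those $P\in\mathbb{P}^n(\overline{k(p)})$ such that a reduced primary decomposition of the saturation $\bigcup_{j}\bigl(J:(x_0,\dots,x_n)^j\bigr)$ has a component that is $m_P$-primary, where $m_P\subset S$ is the ideal generated by the homogeneous polynomials vanishing at $P$. Then the stalk $\pi_*(\mathcal{O}_{Z_u})_p$ is a free $\mathcal{O}_{X,p}$-module of rank $\mu$ if and only if $u$ vanishes at none of the points of $\mathbb{P}^n_{\overline{k(p)}}$ defined by $\overline{I(p)}$. -/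

import Mathlib

open CategoryTheory AlgebraicGeometry
open scoped LinearAlgebra.Projectivization DirectSum

noncomputable section

namespace PunctualHilbert

universe u v

/-! ### The quotient of a graded algebra by a homogeneous ideal -/

section QuotientGrading

variable {R S : Type*} [CommRing R] [CommRing S] [Algebra R S]
  (𝒜 : ℕ → Submodule R S) [GradedAlgebra 𝒜] (I : HomogeneousIdeal 𝒜)

/-- The grading of `S ⧸ I` induced by the grading of `S`: the degree-`d` part is the image of the
degree-`d` part of `S`, that is, `S_d / I_d`. -/
def quotGrading (d : ℕ) : Submodule R (S ⧸ I.toIdeal) :=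
  (𝒜 d).map (Ideal.Quotient.mkₐ R I.toIdeal).toLinearMap

instance quotGrading_gradedMonoid : SetLike.GradedMonoid (quotGrading 𝒜 I) where
  one_mem := ⟨1, SetLike.GradedOne.one_mem, map_one (Ideal.Quotient.mkₐ R I.toIdeal)⟩
  mul_mem := by
    rintro i j _ _ ⟨a, ha, rfl⟩ ⟨b, hb, rfl⟩
    exact ⟨a * b, SetLike.GradedMul.mul_mem ha hb, map_mul (Ideal.Quotient.mkₐ R I.toIdeal) a b⟩

/-- The projection from the degree-`d` part of `S` to the degree-`d` part of `S ⧸ I`. -/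
def toQuotGrading (d : ℕ) : 𝒜 d →ₗ[R] quotGrading 𝒜 I d :=
  (Ideal.Quotient.mkₐ R I.toIdeal).toLinearMap.restrict fun a ha => ⟨a, ha, rfl⟩

/-- Decomposition of the classes of elements of `S` into their homogeneous components. -/
def preQuotDecompose : S →ₗ[R] ⨁ d, quotGrading 𝒜 I d :=
  LinearMap.comp (DirectSum.lmap (toQuotGrading 𝒜 I))
    (DirectSum.decomposeLinearEquiv 𝒜).toLinearMap

theorem le_ker_preQuotDecompose :
    I.toIdeal.restrictScalars R ≤ LinearMap.ker (preQuotDecompose 𝒜 I) := by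
  intro a ha
  change preQuotDecompose 𝒜 I a = 0
  refine DFinsupp.ext fun d => Subtype.ext ?_
  change Ideal.Quotient.mk I.toIdeal (DirectSum.decompose 𝒜 a d : S) = 0
  exact Ideal.Quotient.eq_zero_iff_mem.mpr (I.isHomogeneous d ha)

/-- Decomposition of `S ⧸ I` into its homogeneous components. -/
def quotDecompose : (S ⧸ I.toIdeal) →+ ⨁ d, quotGrading 𝒜 I d :=
  QuotientAddGroup.lift I.toIdeal.toAddSubgroup (preQuotDecompose 𝒜 I).toAddMonoidHom
    fun _ ha => le_ker_preQuotDecompose 𝒜 I ha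

theorem quotDecompose_mk {d : ℕ} (a : 𝒜 d) :
    quotDecompose 𝒜 I (toQuotGrading 𝒜 I d a : S ⧸ I.toIdeal) =
      DirectSum.of (fun d => quotGrading 𝒜 I d) d (toQuotGrading 𝒜 I d a) := by
  change DirectSum.lmap (toQuotGrading 𝒜 I) (DirectSum.decompose 𝒜 (a : S)) = _
  rw [DirectSum.decompose_coe]
  exact DirectSum.lmap_of _ _ _

instance quotGrading_gradedAlgebra : GradedAlgebra (quotGrading 𝒜 I) where
  toDecomposition := DirectSum.Decomposition.ofAddHom _ (quotDecompose 𝒜 I)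
    (by
      refine AddMonoidHom.ext fun x => ?_
      obtain ⟨a, rfl⟩ := Ideal.Quotient.mk_surjective x
      induction a using DirectSum.Decomposition.inductionOn 𝒜 with
      | zero => simp
      | add a b ha hb => rw [map_add, map_add, map_add, ha, hb]
      | homogeneous a =>
        change DirectSum.coeAddMonoidHom (quotGrading 𝒜 I)
          (quotDecompose 𝒜 I (toQuotGrading 𝒜 I _ a : S ⧸ I.toIdeal)) = _
        rw [quotDecompose_mk, DirectSum.coeAddMonoidHom_of]
        rfl)
    (by
      refine DirectSum.addHom_ext fun d x => ?_
      obtain ⟨_, a, ha, rfl⟩ := x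
      change quotDecompose 𝒜 I (DirectSum.coeAddMonoidHom (quotGrading 𝒜 I)
        (DirectSum.of (fun d => quotGrading 𝒜 I d) d (toQuotGrading 𝒜 I d ⟨a, ha⟩))) = _
      rw [DirectSum.coeAddMonoidHom_of, quotDecompose_mk]
      rfl)

end QuotientGrading

/-! ### Homogeneous ideals of polynomial rings, Hilbert polynomials -/

/-- The standard grading of `A[x_0, …, x_n]`. -/
abbrev stdGrading (n : ℕ) (A : Type u) [CommRing A] :
    ℕ → Submodule A (MvPolynomial (Fin (n + 1)) A) :=
  MvPolynomial.homogeneousSubmodule (Fin (n + 1)) A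

instance stdGrading_gradedAlgebra (n : ℕ) (A : Type u) [CommRing A] :
    GradedAlgebra (stdGrading n A) :=
  MvPolynomial.gradedAlgebra

/-- The graded ring homomorphism `A[x_0, …, x_n] → B[x_0, …, x_n]` for an `A`-algebra `B`. -/
def baseChangeHom (n : ℕ) (A : Type u) [CommRing A] (B : Type v) [CommRing B] [Algebra A B] :
    stdGrading n A →+*ᵍ stdGrading n B where
  __ := MvPolynomial.map (algebraMap A B)
  map_mem ha := MvPolynomial.IsHomogeneous.map ha (algebraMap A B)

/-- The homogeneous ideal of `B[x_0, …, x_n]` generated by the image of a homogeneous ideal `I` of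
`A[x_0, …, x_n]`, i.e. the image of `I ⊗_A B` in `B[x_0, …, x_n]`. -/
def extendIdeal {n : ℕ} {A : Type u} [CommRing A] (I : HomogeneousIdeal (stdGrading n A))
    (B : Type v) [CommRing B] [Algebra A B] : HomogeneousIdeal (stdGrading n B) :=
  I.map (baseChangeHom n A B)

/-- `J` has Hilbert polynomial `P`: `dim_k (S_d / J_d) = P(d)` for all large `d`, where
`S = k[x_0, …, x_n]`. -/
def HasHilbertPolynomial {n : ℕ} {k : Type u} [Field k] (J : HomogeneousIdeal (stdGrading n k))
    (P : Polynomial ℚ) : Prop :=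
  ∀ᶠ d : ℕ in Filter.atTop,
    (Module.finrank k (quotGrading (stdGrading n k) J d) : ℚ) = P.eval (d : ℚ)

/-- The ideal `I(p)` of `k(p)[x_0, …, x_n]`: the image of `I ⊗_A k(p)`. -/
abbrev fiberIdeal {n : ℕ} {A : Type u} [CommRing A] (I : HomogeneousIdeal (stdGrading n A))
    (p : PrimeSpectrum A) : HomogeneousIdeal (stdGrading n p.asIdeal.ResidueField) :=
  extendIdeal I p.asIdeal.ResidueField

/-- The ideal of `\overline{k(p)}[x_0, …, x_n]` obtained from `I(p)` by extending scalars to the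
algebraic closure of `k(p)`. -/
abbrev geometricFiberIdeal {n : ℕ} {A : Type u} [CommRing A]
    (I : HomogeneousIdeal (stdGrading n A)) (p : PrimeSpectrum A) :
    HomogeneousIdeal (stdGrading n (AlgebraicClosure p.asIdeal.ResidueField)) :=
  extendIdeal (fiberIdeal I p) (AlgebraicClosure p.asIdeal.ResidueField)

/-! ### Families of closed subschemes of projective space -/

section Family

variable {n : ℕ} {A : Type u} [CommRing A] (I : HomogeneousIdeal (stdGrading n A))

/-- The scheme `Z = Proj (A[x_0, …, x_n] / I)`. -/
abbrev projQuot : Scheme.{u} := Proj (quotGrading (stdGrading n A) I)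

/-- The structure morphism `π : Proj (A[x_0, …, x_n] / I) ⟶ Spec A`. -/
def projQuotToSpec : projQuot I ⟶ Spec (CommRingCat.of A) :=
  Proj.toSpecZero (quotGrading (stdGrading n A) I) ≫
    Spec.map (CommRingCat.ofHom (algebraMap A (quotGrading (stdGrading n A) I 0)))

/-- `Z = Proj (A[x_0, …, x_n] / I)` is an element of `Hilb^μ_{ℙⁿ}(Spec A)`: it is flat over
`Spec A` and all its fibers have Hilbert polynomial equal to the constant `μ`. -/
structure IsHilbFamily (μ : ℕ) : Prop where
  flat : Flat (projQuotToSpec I)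
  hilbertPolynomial (p : PrimeSpectrum A) :
    HasHilbertPolynomial (fiberIdeal I p) (Polynomial.C (μ : ℚ))

/-- The open subscheme `Z_u = D₊(u)` of `Z = Proj (A[x_0, …, x_n] / I)` on which the section of
`𝒪_Z(1)` given by the linear form `u` generates `𝒪_Z(1)`. -/
def nonvanishingLocus (u : MvPolynomial (Fin (n + 1)) A) : (projQuot I).Opens :=
  Proj.basicOpen (quotGrading (stdGrading n A) I) (Ideal.Quotient.mk I.toIdeal u)

end Family

/-- The stalk `(f_* 𝒪_Z)_x` of the direct image of the structure sheaf. -/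
def pushforwardStalk {Z X : Scheme.{u}} (f : Z ⟶ X) (x : X) : CommRingCat.{u} :=
  ((TopCat.Presheaf.pushforward CommRingCat f.base).obj Z.presheaf).stalk x

/-- `(f_* 𝒪_Z)_x` as an algebra (in particular a module) over `𝒪_{X,x}`, via the stalk at `x` of
`𝒪_X ⟶ f_* 𝒪_Z`. -/
instance pushforwardStalk_algebra {Z X : Scheme.{u}} (f : Z ⟶ X) (x : X) :
    Algebra (X.presheaf.stalk x) (pushforwardStalk f x) :=
  ((TopCat.Presheaf.stalkFunctor CommRingCat x).map f.c).hom.toAlgebra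

/-- `(f_* 𝒪_Z)_x` is a free `𝒪_{X,x}`-module of rank `r`. -/
def PushforwardStalkFreeOfRank {Z X : Scheme.{u}} (f : Z ⟶ X) (x : X) (r : ℕ) : Prop :=
  Module.Free (X.presheaf.stalk x) (pushforwardStalk f x) ∧
    Module.rank (X.presheaf.stalk x) (pushforwardStalk f x) = r

/-! ### The points of projective space defined by a homogeneous ideal -/

section Points

variable {n : ℕ} {k : Type u} [Field k]

/-- The homogeneous ideal `m_P` of a point `P` of `ℙⁿ(k)`, generated by the homogeneous
polynomials vanishing at `P`. -/
def pointIdeal (P : ℙ k (Fin (n + 1) → k)) : Ideal (MvPolynomial (Fin (n + 1)) k) :=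
  Ideal.span {Q | (∃ d, Q.IsHomogeneous d) ∧ MvPolynomial.eval P.rep Q = 0}

/-- The saturation `⋃_j (J : m^j)`, with `m` the ideal generated by the homogeneous polynomials of
positive degree (the supremum is over an increasing chain, so it is the union). -/
def saturation (J : HomogeneousIdeal (stdGrading n k)) : Ideal (MvPolynomial (Fin (n + 1)) k) :=
  ⨆ j : ℕ, J.toIdeal.colon
    (((HomogeneousIdeal.irrelevant (stdGrading n k)).toIdeal ^ j :
      Ideal (MvPolynomial (Fin (n + 1)) k)) : Set (MvPolynomial (Fin (n + 1)) k))

/-- The set of points defined by `J`: the points `P` such that some component of a reduced primary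
decomposition of the saturation of `J` is `m_P`-primary. (The radicals of the components do not
depend on the decomposition.) -/
def pointsDefinedBy (J : HomogeneousIdeal (stdGrading n k)) : Set (ℙ k (Fin (n + 1) → k)) :=
  {P | ∃ t : Finset (Ideal (MvPolynomial (Fin (n + 1)) k)),
    Submodule.IsMinimalPrimaryDecomposition (saturation J) t ∧ ∃ q ∈ t, q.radical = pointIdeal P}

/-- The polynomial `u`, with coefficients in a ring `K` mapping to `k`, vanishes at the point `P`
of `ℙⁿ(k)`. -/
def VanishesAt {K : Type v} [CommRing K] [Algebra K k] (u : MvPolynomial (Fin (n + 1)) K)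
    (P : ℙ k (Fin (n + 1) → k)) : Prop :=
  MvPolynomial.aeval P.rep u = 0

end Points

end PunctualHilbert

end

noncomputable section

namespace PunctualHilbert

universe u v

/-! ### Saturation of a homogeneous ideal and its primary components -/

section SaturationResults

open MvPolynomial

section Saturation

variable {n : ℕ} {k : Type u} [Field k]

/-! Write `L` for the algebraic closure of `k(p)`, `R = A[x]/I`, `J` for the extension of `I` to
`L[x]`, and `l` for the image of `u`. Both sides of the equivalence say that multiplication by `l`
on `L[x]/J` is injective in all large degrees.

Points (`forall_notMem_pointIdeal_iff`): `J` agrees with its saturation in large degrees, so this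
injectivity says that `l` is a non-zero-divisor modulo the saturation, i.e. that it avoids its
associated primes. A homogeneous associated prime misses some variable, and the constant Hilbert
polynomial forces every ratio of variables modulo it to be a scalar, so it is the ideal of a point.

Freeness (`pushforwardStalkFreeOfRank_iff`): `Z_u` is affine with ring `B = (R_l)_0`, the colimit of
the `R_d` under multiplication by `l`, and the stalk is `B_p`. If it is free of rank `μ`, then `L ⊗
B` has dimension `μ` and is the image of `L ⊗ R_d` for large `d`; that space also has dimension `μ`,
so the map is bijective, and it factors through multiplication by `l`. Conversely, injectivity
between fibres of equal dimension is surjectivity. By Nakayama and generation of `R` in degree one,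
`B_p` is then the localized image of a single `R_d`, hence finite. Being flat over a local ring it
is free, and its rank is `μ` because `R_d` and its image in `B` have the same fibre: a power of `l`
kills the kernel of `R_d → B` but is injective on `L ⊗ R_d`. -/

theorem decompose_stdGrading {A : Type u} [CommRing A] (f : MvPolynomial (Fin (n + 1)) A) (d : ℕ) :
    (DirectSum.decompose (stdGrading n A) f d : MvPolynomial (Fin (n + 1)) A) =
      homogeneousComponent d f := by
  nth_rw 1 [← sum_homogeneousComponent f]
  rw [DirectSum.decompose_sum, DirectSum.sum_apply, AddSubmonoidClass.coe_finsetSum]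
  have h : ∀ i, (DirectSum.decompose (stdGrading n A) (homogeneousComponent i f) d :
      MvPolynomial (Fin (n + 1)) A) = if i = d then homogeneousComponent d f else 0 := fun i => by
    have hi : homogeneousComponent i f ∈ stdGrading n A i := homogeneousComponent_isHomogeneous i f
    split_ifs with hid
    · subst hid
      exact DirectSum.decompose_of_mem_same _ hi
    · exact DirectSum.decompose_of_mem_ne _ hi hid
  simp only [h, Finset.sum_ite_eq', Finset.mem_range]
  split_ifs with hd
  · rfl
  · exact (homogeneousComponent_eq_zero _ _ (by omega)).symm

theorem homogeneousComponent_mul_of_isHomogeneous {A : Type u} [CommRing A]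
    {f g : MvPolynomial (Fin (n + 1)) A} {e : ℕ} (hg : g.IsHomogeneous e) (d : ℕ) :
    homogeneousComponent (d + e) (f * g) = homogeneousComponent d f * g := by
  rw [← decompose_stdGrading, ← decompose_stdGrading]
  exact DirectSum.coe_decompose_mul_add_of_right_mem (stdGrading n A) hg

theorem mem_of_forall_homogeneousComponent_mem {A : Type u} [CommRing A]
    {J : Ideal (MvPolynomial (Fin (n + 1)) A)} {f : MvPolynomial (Fin (n + 1)) A}
    (h : ∀ d, homogeneousComponent d f ∈ J) : f ∈ J := by
  rw [← sum_homogeneousComponent f]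
  exact J.sum_mem fun d _ => h d

theorem irrelevant_stdGrading :
    (HomogeneousIdeal.irrelevant (stdGrading n k)).toIdeal = idealOfVars (Fin (n + 1)) k := by
  ext f
  have h1 : f ∈ (HomogeneousIdeal.irrelevant (stdGrading n k)).toIdeal ↔
      homogeneousComponent 0 f = 0 := by
    rw [← decompose_stdGrading]
    exact HomogeneousIdeal.mem_irrelevant_iff _ f
  rw [h1, ← pow_one (idealOfVars (Fin (n + 1)) k), mem_pow_idealOfVars_iff', homogeneousComponent_zero]
  simp [Finsupp.degree_eq_zero_iff]

theorem _root_.MvPolynomial.IsHomogeneous.mem_pow_idealOfVars {f : MvPolynomial (Fin (n + 1)) k}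
    {d j : ℕ} (hf : f.IsHomogeneous d) (h : j ≤ d) : f ∈ idealOfVars (Fin (n + 1)) k ^ j := by
  rw [mem_pow_idealOfVars_iff']
  intro x hx
  exact hf.coeff_eq_zero (by omega)

variable (J : HomogeneousIdeal (stdGrading n k))

theorem mem_saturation_iff {f : MvPolynomial (Fin (n + 1)) k} :
    f ∈ saturation J ↔ ∃ j, ∀ h ∈ idealOfVars (Fin (n + 1)) k ^ j, f * h ∈ J.toIdeal := by
  rw [saturation, Submodule.mem_iSup_of_directed]
  · simp only [irrelevant_stdGrading, Submodule.mem_colon, SetLike.mem_coe, smul_eq_mul]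
  · refine Monotone.directed_le fun i j hij => Submodule.colon_mono le_rfl ?_
    exact Ideal.pow_le_pow_right hij

/-- Monomials of degree `j` generate the `j`-th power of the irrelevant ideal. Being homogeneous,
they only shift homogeneous components, which permits arguments degree by degree. -/
theorem mem_saturation_of_monomial {f : MvPolynomial (Fin (n + 1)) k} (j : ℕ)
    (h : ∀ a : Fin (n + 1) →₀ ℕ, a.degree = j → f * monomial a 1 ∈ J.toIdeal) :
    f ∈ saturation J := by
  rw [mem_saturation_iff]
  refine ⟨j, fun g hg => ?_⟩
  rw [pow_idealOfVars_eq_span] at hg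
  induction hg using Submodule.span_induction with
  | mem x hx =>
    obtain ⟨a, ha, rfl⟩ := hx
    exact h a ha
  | zero => simp
  | add x y _ _ hx hy => rw [mul_add]; exact add_mem hx hy
  | smul c x _ hx => rw [smul_eq_mul, mul_left_comm]; exact Ideal.mul_mem_left _ _ hx

theorem le_saturation : J.toIdeal ≤ saturation J := fun _ hf =>
  (mem_saturation_iff J).mpr ⟨0, fun _ _ => Ideal.mul_mem_right _ _ hf⟩

theorem homogeneousComponent_mem_of_mem {f : MvPolynomial (Fin (n + 1)) k}
    (hf : f ∈ J.toIdeal) (d : ℕ) : homogeneousComponent d f ∈ J.toIdeal := by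
  rw [← decompose_stdGrading]
  exact J.isHomogeneous d hf

theorem isHomogeneous_saturation : (saturation J).IsHomogeneous (stdGrading n k) := by
  intro d f hf
  rw [decompose_stdGrading]
  obtain ⟨j, hj⟩ := (mem_saturation_iff J).mp hf
  refine mem_saturation_of_monomial J j fun a ha => ?_
  have hm : (monomial a (1 : k)).IsHomogeneous j := isHomogeneous_monomial _ ha
  rw [← homogeneousComponent_mul_of_isHomogeneous hm]
  exact homogeneousComponent_mem_of_mem J (hj _ (hm.mem_pow_idealOfVars le_rfl)) _

/-- A single power of the irrelevant ideal maps the whole saturation into the ideal. -/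
theorem exists_pow_mul_saturation_le :
    ∃ j, ∀ f ∈ saturation J, ∀ h ∈ idealOfVars (Fin (n + 1)) k ^ j, f * h ∈ J.toIdeal := by
  obtain ⟨G, hG⟩ := (isNoetherianRing_iff_ideal_fg _).mp inferInstance (saturation J)
  have h1 : ∀ g : G, ∃ j, ∀ h ∈ idealOfVars (Fin (n + 1)) k ^ j, g.1 * h ∈ J.toIdeal := fun g =>
    (mem_saturation_iff J).mp (hG ▸ Submodule.subset_span g.2)
  choose j hj using h1
  refine ⟨Finset.univ.sup j, fun f hf h hh => ?_⟩
  rw [← hG] at hf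
  induction hf using Submodule.span_induction with
  | mem x hx =>
    exact hj ⟨x, hx⟩ h (Ideal.pow_le_pow_right (Finset.le_sup (Finset.mem_univ _)) hh)
  | zero => simp
  | add x y _ _ hx hy => rw [add_mul]; exact add_mem hx hy
  | smul c x _ hx => rw [smul_eq_mul, mul_assoc]; exact Ideal.mul_mem_left _ _ hx

/-- Split `c` into monomials: one of degree at least `j` sends `x` into `J`, and one of smaller
degree cannot lift `x` to degree `d`. -/
theorem homogeneousComponent_mul_mem {x : MvPolynomial (Fin (n + 1)) k} {D j : ℕ}
    (hD : x.totalDegree ≤ D) (hx : ∀ h ∈ idealOfVars (Fin (n + 1)) k ^ j, x * h ∈ J.toIdeal)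
    {d : ℕ} (hd : D + j ≤ d) (c : MvPolynomial (Fin (n + 1)) k) :
    homogeneousComponent d (x * c) ∈ J.toIdeal := by
  induction c using MvPolynomial.induction_on' with
  | add p q hp hq => rw [mul_add, map_add]; exact add_mem hp hq
  | monomial a r =>
    have hm : (monomial a r).IsHomogeneous a.degree := isHomogeneous_monomial _ rfl
    rcases le_or_gt j a.degree with h | h
    · exact homogeneousComponent_mem_of_mem J (hx _ (hm.mem_pow_idealOfVars h)) d
    · obtain ⟨e, rfl⟩ : ∃ e, d = e + a.degree := ⟨d - a.degree, by omega⟩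
      rw [homogeneousComponent_mul_of_isHomogeneous hm,
        homogeneousComponent_eq_zero _ _ (by omega), zero_mul]
      exact zero_mem _

/-- An ideal and its saturation agree in large degrees. -/
theorem exists_forall_mem_of_mem_saturation :
    ∃ d₀, ∀ d ≥ d₀, ∀ f : MvPolynomial (Fin (n + 1)) k, f.IsHomogeneous d →
      f ∈ saturation J → f ∈ J.toIdeal := by
  obtain ⟨j, hj⟩ := exists_pow_mul_saturation_le J
  obtain ⟨G, hG⟩ := (isNoetherianRing_iff_ideal_fg _).mp inferInstance (saturation J)
  refine ⟨G.sup totalDegree + j, fun d hd f hf hfs => ?_⟩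
  suffices H : homogeneousComponent d f ∈ J.toIdeal by
    rwa [homogeneousComponent_of_mem hf, if_pos rfl] at H
  clear hf
  rw [← hG] at hfs
  obtain ⟨c, -, rfl⟩ := Submodule.mem_span_finset.mp hfs
  rw [map_sum]
  refine sum_mem fun g hg => ?_
  rw [smul_eq_mul, mul_comm]
  exact homogeneousComponent_mul_mem J (Finset.le_sup (f := totalDegree) hg)
    (hj g (hG ▸ Submodule.subset_span hg)) hd _

-- Multiplying `f` by monomials of high degree moves all its components into the range where
-- cancellation of `l` is allowed.
variable {J} in
theorem mem_saturation_of_mul_mem {l : MvPolynomial (Fin (n + 1)) k} (hl : l.IsHomogeneous 1)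
    {d₀ : ℕ} (h : ∀ d ≥ d₀, ∀ g : MvPolynomial (Fin (n + 1)) k, g.IsHomogeneous d →
      l * g ∈ J.toIdeal → g ∈ J.toIdeal)
    {f : MvPolynomial (Fin (n + 1)) k} (hf : l * f ∈ saturation J) : f ∈ saturation J := by
  obtain ⟨j, hj⟩ := (mem_saturation_iff J).mp hf
  -- The summand `j` brings `l * f` into `J`; the summand `d₀` makes every component large enough
  -- for `h`.
  refine mem_saturation_of_monomial J (j + d₀) fun a ha => ?_
  have hm : (monomial a (1 : k)).IsHomogeneous (j + d₀) := isHomogeneous_monomial _ ha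
  rw [← sum_homogeneousComponent f, Finset.sum_mul]
  refine sum_mem fun e _ => ?_
  refine h (e + (j + d₀)) (by omega) _ ((homogeneousComponent_isHomogeneous e f).mul hm) ?_
  have h1 := homogeneousComponent_mem_of_mem J
    (hj _ (hm.mem_pow_idealOfVars (by omega))) (e + (1 + (j + d₀)))
  rw [mul_comm l f, mul_assoc, homogeneousComponent_mul_of_isHomogeneous (hl.mul hm)] at h1
  rwa [mul_left_comm]

end Saturation

section PointIdeal

variable {n : ℕ} {k : Type u} [Field k]

theorem mem_pointIdeal_iff {P : ℙ k (Fin (n + 1) → k)} {f : MvPolynomial (Fin (n + 1)) k} {d : ℕ}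
    (hf : f.IsHomogeneous d) : f ∈ pointIdeal P ↔ eval P.rep f = 0 := by
  refine ⟨fun h => ?_, fun h => Ideal.subset_span ⟨⟨d, hf⟩, h⟩⟩
  have : pointIdeal P ≤ RingHom.ker (eval P.rep) := Ideal.span_le.mpr fun Q hQ => hQ.2
  exact this h

/-- A non-zero-divisor modulo the saturation vanishes at no point. -/
theorem notMem_pointIdeal_of_mem_pointsDefinedBy {J : HomogeneousIdeal (stdGrading n k)}
    {l : MvPolynomial (Fin (n + 1)) k} (h : ∀ f, l * f ∈ saturation J → f ∈ saturation J)
    {P : ℙ k (Fin (n + 1) → k)} (hP : P ∈ pointsDefinedBy J) : l ∉ pointIdeal P := by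
  classical
  obtain ⟨t, ht, q, hq, hqP⟩ := hP
  intro hl
  rw [← hqP] at hl
  obtain ⟨m, hm⟩ := hl
  -- Irredundancy gives `g` outside `q` but in all other components, so `l ^ m * g` lies in every
  -- component.
  obtain ⟨g, hg, hgq⟩ := SetLike.not_le_iff_exists.mp (ht.minimal hq)
  have h1 : ∀ m, l ^ m * g ∈ saturation J → g ∈ saturation J := by
    intro m
    induction m with
    | zero => simp
    | succ m ih => intro hh; exact ih (h _ (by rwa [← mul_assoc, ← pow_succ']))
  apply hgq
  have h2 : l ^ m * g ∈ saturation J := by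
    rw [← ht.inf_eq, ← Finset.insert_erase hq, Finset.inf_insert]
    exact ⟨Ideal.mul_mem_right _ _ hm, Ideal.mul_mem_left _ _ hg⟩
  have h3 := h1 m h2
  rw [← ht.inf_eq] at h3
  exact Finset.inf_le (f := id) hq h3

/-- Radicals of components of a primary decomposition are the prime ideals of the form `(I : f)`. -/
theorem mem_pointsDefinedBy_of_colon {J : HomogeneousIdeal (stdGrading n k)}
    {P : ℙ k (Fin (n + 1) → k)} {f : MvPolynomial (Fin (n + 1)) k}
    (hf : ∀ a, a ∈ pointIdeal P ↔ a * f ∈ saturation J) (hprime : (pointIdeal P).IsPrime) :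
    P ∈ pointsDefinedBy J := by
  obtain ⟨t, ht⟩ := Submodule.IsLasker.exists_isMinimalPrimaryDecomposition
    (Submodule.isLasker (MvPolynomial (Fin (n + 1)) k) (MvPolynomial (Fin (n + 1)) k)) (saturation J)
  refine ⟨t, ht, ?_⟩
  -- The colon by `f` distributes over the decomposition; a prime containing a finite intersection
  -- contains one of its terms.
  have h0 : t.inf (fun q : Ideal _ => q.colon {f}) ≤ pointIdeal P := by
    intro a ha
    rw [hf, ← ht.inf_eq]
    simp only [Submodule.mem_finsetInf, id] at ha ⊢
    exact fun q hq => by simpa using ha q hq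
  obtain ⟨q, hq, hqP⟩ := hprime.inf_le'.mp h0
  refine ⟨q, hq, ?_⟩
  have hfq : f ∉ q := by
    intro hfq
    refine hprime.ne_top ((Ideal.eq_top_iff_one _).mpr (hqP ?_))
    simpa using hfq
  have hprim : q.IsPrimary := ht.primary hq
  refine le_antisymm (hprime.radical_le_iff.mpr fun a ha => hqP ?_) fun a ha => ?_
  · simpa using Ideal.mul_mem_right _ _ ha
  · have h1 : f * a ∈ q := by
      have := (hf a).mp ha
      rw [← ht.inf_eq] at this
      rw [mul_comm]
      exact Finset.inf_le (f := id) hq this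
    exact ((Ideal.isPrimary_iff.mp hprim).2 h1).resolve_left hfq

end PointIdeal

end SaturationResults

/-! ### Associated primes of the saturation are ideals of points -/

section PointsResults

open MvPolynomial

section FiniteDegree

variable {n : ℕ} {A : Type u} [CommRing A] (I : HomogeneousIdeal (stdGrading n A))

instance quotGrading_finite (d : ℕ) : Module.Finite A (quotGrading (stdGrading n A) I d) :=
  Module.Finite.iff_fg.mpr ((homogeneousSubmodule_fg _ _ d).map _)

theorem mk_mem_quotGrading {d : ℕ} {f : MvPolynomial (Fin (n + 1)) A} (hf : f.IsHomogeneous d) :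
    Ideal.Quotient.mk I.toIdeal f ∈ quotGrading (stdGrading n A) I d :=
  ⟨f, hf, rfl⟩

end FiniteDegree

/-- Each monomial of degree `d` contributes a factor `t ^ d`. This serves both for changing the
representative of a point and for computing modulo a prime where every variable is a multiple of one
variable. -/
theorem _root_.MvPolynomial.IsHomogeneous.aeval_smul_const {σ k B : Type*} [Fintype σ] [CommRing k]
    [CommRing B] [Algebra k B] {Q : MvPolynomial σ k} {d : ℕ} (hQ : Q.IsHomogeneous d) (c : σ → k)
    (t : B) : aeval (fun j => c j • t) Q = algebraMap k B (eval c Q) * t ^ d := by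
  rw [aeval_def, eval₂_eq', eval_eq', map_sum, Finset.sum_mul]
  refine Finset.sum_congr rfl fun a ha => ?_
  have had : ∑ i, a i = d := by
    rw [← Finsupp.degree_eq_sum]
    by_contra hne
    exact mem_support_iff.mp ha (hQ.coeff_eq_zero hne)
  simp only [Algebra.smul_def, mul_pow, Finset.prod_mul_distrib, Finset.prod_pow_eq_pow_sum, had,
    map_mul, map_prod, map_pow]
  ring

section AlgClosed

variable {n : ℕ} {k : Type u} [Field k]

/-- A maximal colon ideal among those of homogeneous elements outside the saturation that `l`
multiplies into it is prime; homogeneity reduces primality to homogeneous factors. -/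
theorem exists_isPrime_colon {J : HomogeneousIdeal (stdGrading n k)}
    {l f : MvPolynomial (Fin (n + 1)) k} {d : ℕ} (hf : f.IsHomogeneous d)
    (hfs : f ∉ saturation J) (hlf : l * f ∈ saturation J) :
    ∃ (q : Ideal (MvPolynomial (Fin (n + 1)) k)) (g : MvPolynomial (Fin (n + 1)) k),
      q.IsHomogeneous (stdGrading n k) ∧ q.IsPrime ∧ l ∈ q ∧ ∀ a, a ∈ q ↔ a * g ∈ saturation J := by
  let T : Set (Ideal (MvPolynomial (Fin (n + 1)) k)) :=
    {q | ∃ g e, g.IsHomogeneous e ∧ g ∉ saturation J ∧ l * g ∈ saturation J ∧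
      q = (saturation J).colon {g}}
  obtain ⟨q, ⟨g, e, hg, hgs, hlg, rfl⟩, hmax⟩ :=
    set_has_maximal_iff_noetherian.mpr
      (inferInstance : IsNoetherian (MvPolynomial (Fin (n + 1)) k) _) T
      ⟨_, f, d, hf, hfs, hlf, rfl⟩
  have hhom : ((saturation J).colon {g}).IsHomogeneous (stdGrading n k) := by
    intro i a ha
    rw [decompose_stdGrading]
    simp only [Submodule.mem_colon_singleton, smul_eq_mul] at ha ⊢
    rw [← homogeneousComponent_mul_of_isHomogeneous hg, ← decompose_stdGrading]
    exact isHomogeneous_saturation J _ ha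
  refine ⟨_, g, hhom, ?_, by simpa using hlg, by simp⟩
  refine hhom.isPrime_of_homogeneous_mem_or_mem ?_ ?_
  · rw [Ideal.ne_top_iff_one]
    simpa using hgs
  · rintro a b ⟨i, ha⟩ - hab
    by_contra! hcon
    obtain ⟨hag, hbg⟩ := hcon
    simp only [Submodule.mem_colon_singleton, smul_eq_mul] at hag hab
    -- If neither `a` nor `b` lay in the colon ideal of `g`, that of `a * g` would be strictly
    -- larger, as it contains `b`.
    refine hmax ((saturation J).colon {a * g}) ⟨a * g, i + e, ?_, hag, ?_, rfl⟩ ?_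
    · exact IsHomogeneous.mul ha hg
    · rw [mul_left_comm]; exact Ideal.mul_mem_left _ _ hlg
    · refine lt_of_le_of_ne (fun x hx => ?_) fun heq => hbg ?_
      · simp only [Submodule.mem_colon_singleton, smul_eq_mul] at hx ⊢
        rw [mul_left_comm]; exact Ideal.mul_mem_left _ _ hx
      · rw [heq]
        simp only [Submodule.mem_colon_singleton, smul_eq_mul]
        rwa [← mul_assoc, mul_comm b a]

/-- If `q` contained all variables, a power of the irrelevant ideal would send `g` into `J`; then
`g` would be in the saturation and `q` would be the unit ideal. -/
theorem exists_X_notMem {J : HomogeneousIdeal (stdGrading n k)}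
    {q : Ideal (MvPolynomial (Fin (n + 1)) k)} {g : MvPolynomial (Fin (n + 1)) k} (hq : q.IsPrime)
    (hqg : ∀ a, a ∈ q ↔ a * g ∈ saturation J) : ∃ i, X i ∉ q := by
  by_contra! h
  have h1 : idealOfVars (Fin (n + 1)) k ≤ q := Ideal.span_le.mpr (by rintro _ ⟨i, rfl⟩; exact h i)
  obtain ⟨j, hj⟩ := exists_pow_mul_saturation_le J
  refine hq.ne_top ((Ideal.eq_top_iff_one _).mpr ((hqg 1).mpr ?_))
  rw [one_mul]
  refine mem_saturation_of_monomial J (j + 1) fun a ha => ?_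
  have hm : monomial a (1 : k) ∈ idealOfVars (Fin (n + 1)) k ^ (j + 1) :=
    (isHomogeneous_monomial (1 : k) ha).mem_pow_idealOfVars le_rfl
  rw [pow_succ'] at hm
  generalize monomial a (1 : k) = m at hm
  induction hm using Submodule.mul_induction_on' with
  | mem_mul_mem x hx y hy =>
    have := hj _ ((hqg x).mp (h1 hx)) y hy
    rwa [mul_comm x g, mul_assoc] at this
  | add x _ y _ hx hy => rw [mul_add]; exact add_mem hx hy

/-- In a degree where the quotient has dimension `μ`, the `μ + 1` monomials in `X j` and `X i` used
here are dependent. Dehomogenizing makes `X j / X i` algebraic over `k` in the fraction field modulo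
`q`, hence a scalar. -/
theorem exists_X_sub_C_mul_X_mem [IsAlgClosed k] {J : HomogeneousIdeal (stdGrading n k)} {μ : ℕ}
    (hJ : ∀ᶠ d : ℕ in Filter.atTop, Module.finrank k (quotGrading (stdGrading n k) J d) = μ)
    {q : Ideal (MvPolynomial (Fin (n + 1)) k)} (hq : q.IsPrime) (hJq : J.toIdeal ≤ q)
    {i : Fin (n + 1)} (hi : X i ∉ q) (j : Fin (n + 1)) : ∃ c : k, X j - C c * X i ∈ q := by
  -- `M ≥ μ` keeps the exponents `M - m` genuine for all `m ≤ μ`.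
  obtain ⟨M, hM, hMμ⟩ := (hJ.and (Filter.eventually_ge_atTop μ)).exists
  have hv : ∀ m : Fin (μ + 1),
      (X j ^ (m : ℕ) * X i ^ (M - m) : MvPolynomial (Fin (n + 1)) k).IsHomogeneous M := by
    intro m
    have := (isHomogeneous_X_pow (R := k) j m).mul (isHomogeneous_X_pow (R := k) i (M - m))
    rwa [Nat.add_sub_cancel' (by omega)] at this
  have hdep : ¬ LinearIndependent k (fun m : Fin (μ + 1) =>
      (⟨_, mk_mem_quotGrading J (hv m)⟩ : quotGrading (stdGrading n k) J M)) := by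
    intro h
    have := h.fintype_card_le_finrank
    rw [hM, Fintype.card_fin] at this
    omega
  obtain ⟨g, hg, m₀, hm₀⟩ := Fintype.not_linearIndependent_iff.mp hdep
  have hmem : ∑ m : Fin (μ + 1), C (g m) * (X j ^ (m : ℕ) * X i ^ (M - m)) ∈ q := by
    refine hJq (Ideal.Quotient.eq_zero_iff_mem.mp ?_)
    have := congrArg Subtype.val hg
    rw [AddSubmonoidClass.coe_finsetSum] at this
    rw [map_sum]
    refine Eq.trans (Finset.sum_congr rfl fun m _ => ?_) this
    rw [← MvPolynomial.smul_eq_C_mul]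
    rfl
  let F := FractionRing (MvPolynomial (Fin (n + 1)) k ⧸ q)
  let φ : MvPolynomial (Fin (n + 1)) k →ₐ[k] F :=
    (IsScalarTower.toAlgHom k (MvPolynomial (Fin (n + 1)) k ⧸ q) F).comp (Ideal.Quotient.mkₐ k q)
  have hφ : ∀ f, φ f = 0 ↔ f ∈ q := fun f => by
    have : φ f = algebraMap _ F (Ideal.Quotient.mk q f) := rfl
    rw [this, FaithfulSMul.algebraMap_eq_zero_iff, Ideal.Quotient.eq_zero_iff_mem]
  have hi0 : φ (X i) ≠ 0 := fun h => hi ((hφ _).mp h)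
  let p : Polynomial k := ∑ m : Fin (μ + 1), Polynomial.monomial (m : ℕ) (g m)
  have hp : p ≠ 0 := by
    intro h
    apply hm₀
    have := congrArg (fun r : Polynomial k => r.coeff (m₀ : ℕ)) h
    simpa [p, Polynomial.finsetSum_coeff, Polynomial.coeff_monomial, Fin.val_inj] using this
  have hroot : Polynomial.aeval (φ (X j) / φ (X i)) p = 0 := by
    have h1 := (hφ _).mpr hmem
    have h2 : φ (X i) ^ M * Polynomial.aeval (φ (X j) / φ (X i)) p = 0 := by
      refine Eq.trans ?_ h1
      rw [map_sum, map_sum, Finset.mul_sum]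
      refine Finset.sum_congr rfl fun m _ => ?_
      rw [Polynomial.aeval_monomial, map_mul, map_mul, map_pow, map_pow]
      have hC : φ (C (g m)) = algebraMap k F (g m) := φ.commutes (g m)
      have hMm : φ (X i) ^ M = φ (X i) ^ (m : ℕ) * φ (X i) ^ (M - m) := by
        rw [← pow_add, Nat.add_sub_cancel' (by omega)]
      rw [hC, hMm, div_pow]
      calc _ = algebraMap k F (g m) *
            (φ (X j) ^ (m : ℕ) / φ (X i) ^ (m : ℕ) * φ (X i) ^ (m : ℕ) * φ (X i) ^ (M - m)) := by ring
        _ = _ := by rw [div_mul_cancel₀ _ (pow_ne_zero _ hi0)]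
    exact (mul_eq_zero.mp h2).resolve_left (pow_ne_zero _ hi0)
  have hint : IsIntegral k (φ (X j) / φ (X i)) := 
    IsAlgebraic.isIntegral ⟨p, hp, hroot⟩
  obtain ⟨c, hc⟩ := minpoly.mem_range_of_degree_eq_one k (φ (X j) / φ (X i))
    (IsAlgClosed.degree_eq_one_of_irreducible k (minpoly.irreducible hint))
  refine ⟨c, (hφ _).mp ?_⟩
  have hC : φ (C c) = algebraMap k F c := φ.commutes c
  rw [map_sub, map_mul, hC, hc, div_mul_cancel₀ _ hi0, sub_self]

/-- Modulo `q`, a form `Q` of degree `d` equals its value at `c` times `X i ^ d`, and `X i` is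
nonzero there; so `q` is cut out by vanishing at `c`. -/
theorem exists_eq_pointIdeal {q : Ideal (MvPolynomial (Fin (n + 1)) k)}
    (hhom : q.IsHomogeneous (stdGrading n k)) (hq : q.IsPrime) {i : Fin (n + 1)} (hi : X i ∉ q)
    (h : ∀ j, ∃ c : k, X j - C c * X i ∈ q) : ∃ P, q = pointIdeal P := by
  choose c hc using h
  -- This makes `c` nonzero, so that it represents a point.
  have hci : c i = 1 := by
    by_contra hne
    have h1 : C (1 - c i) * X i ∈ q := by simpa [sub_mul] using hc i
    refine hi ((Ideal.unit_mul_mem_iff_mem q ?_).mp h1)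
    exact (isUnit_iff_ne_zero.mpr (sub_ne_zero.mpr (Ne.symm hne))).map C
  have hc0 : c ≠ 0 := fun h0 => by simp [h0] at hci
  have key : ∀ {Q : MvPolynomial (Fin (n + 1)) k} {d : ℕ}, Q.IsHomogeneous d →
      (Q ∈ q ↔ eval c Q = 0) := by
    intro Q d hQ
    have h1 : Ideal.Quotient.mk q Q =
        algebraMap k _ (eval c Q) * Ideal.Quotient.mk q (X i) ^ d := by
      rw [← hQ.aeval_smul_const]
      have h2 : Ideal.Quotient.mkₐ k q = aeval (fun j => c j • Ideal.Quotient.mk q (X i)) := by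
        refine MvPolynomial.algHom_ext fun j => ?_
        have h3 := Ideal.Quotient.eq.mpr (hc j)
        rw [← MvPolynomial.smul_eq_C_mul] at h3
        rw [aeval_X]
        exact h3
      exact DFunLike.congr_fun h2 Q
    rw [← Ideal.Quotient.eq_zero_iff_mem, h1, mul_eq_zero_iff_right (pow_ne_zero _ ?_),
      map_eq_zero]
    rwa [Ne, Ideal.Quotient.eq_zero_iff_mem]
  refine ⟨Projectivization.mk k c hc0, ?_⟩
  obtain ⟨a, ha⟩ := Projectivization.exists_smul_eq_mk_rep k c hc0
  have hrep : ∀ {Q : MvPolynomial (Fin (n + 1)) k} {d : ℕ}, Q.IsHomogeneous d →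
      (eval (Projectivization.mk k c hc0).rep Q = 0 ↔ eval c Q = 0) := by
    intro Q d hQ
    rw [← ha]
    have := hQ.aeval_smul_const (B := k) c (a : k)
    have h1 : (fun j => c j • (a : k)) = a • c := by
      funext j
      simp [Units.smul_def, mul_comm]
    have h2 : aeval (a • c) Q = eval (a • c) Q := RingHom.congr_fun (coe_aeval_eq_eval _) Q
    rw [h1, h2] at this
    simp [this]
  refine le_antisymm (fun f hf => ?_) (Ideal.span_le.mpr ?_)
  · refine mem_of_forall_homogeneousComponent_mem fun d => ?_
    have h1 := homogeneousComponent_isHomogeneous (R := k) d f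
    rw [mem_pointIdeal_iff h1, hrep h1, ← key h1, ← decompose_stdGrading]
    exact hhom d hf
  · rintro Q ⟨⟨d, hQ⟩, hQ0⟩
    exact (key hQ).mpr ((hrep hQ).mp hQ0)

/-- A linear form `l` vanishes at none of the points defined by a homogeneous ideal with constant
Hilbert polynomial if and only if multiplication by `l` is injective in large degrees. -/
theorem forall_notMem_pointIdeal_iff [IsAlgClosed k] {J : HomogeneousIdeal (stdGrading n k)} {μ : ℕ}
    (hJ : ∀ᶠ d : ℕ in Filter.atTop, Module.finrank k (quotGrading (stdGrading n k) J d) = μ)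
    {l : MvPolynomial (Fin (n + 1)) k} (hl : l.IsHomogeneous 1) :
    (∀ P ∈ pointsDefinedBy J, l ∉ pointIdeal P) ↔
      ∃ d₀, ∀ d ≥ d₀, ∀ g : MvPolynomial (Fin (n + 1)) k, g.IsHomogeneous d →
        l * g ∈ J.toIdeal → g ∈ J.toIdeal := by
  constructor
  · intro h
    obtain ⟨d₀, hd₀⟩ := exists_forall_mem_of_mem_saturation J
    refine ⟨d₀, fun d hd g hg hlg => hd₀ d hd g hg ?_⟩
    by_contra hgs
    obtain ⟨q, f, hhom, hq, hlq, hqf⟩ := exists_isPrime_colon hg hgs (le_saturation J hlg)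
    obtain ⟨i, hi⟩ := exists_X_notMem hq hqf
    have hJq : J.toIdeal ≤ q := fun a ha =>
      (hqf a).mpr (Ideal.mul_mem_right _ _ (le_saturation J ha))
    obtain ⟨P, rfl⟩ := exists_eq_pointIdeal hhom hq hi (exists_X_sub_C_mul_X_mem hJ hq hJq hi)
    exact h P (mem_pointsDefinedBy_of_colon hqf hq) hlq
  · rintro ⟨d₀, hd₀⟩ P hP
    exact notMem_pointIdeal_of_mem_pointsDefinedBy
      (fun f hf => mem_saturation_of_mul_mem hl hd₀ hf) hP

end AlgClosed

end PointsResults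

/-! ### Base change of graded pieces and of multiplication by a linear form -/

section BaseChangeResults

open MvPolynomial TensorProduct

section BaseChange

variable {n : ℕ} {A : Type u} [CommRing A] (I : HomogeneousIdeal (stdGrading n A))
  (B : Type v) [CommRing B] [Algebra A B]

theorem toIdeal_extendIdeal :
    (extendIdeal I B).toIdeal = I.toIdeal.map (MvPolynomial.map (algebraMap A B)) :=
  rfl

/-- Forming `S / I` commutes with base change. -/
def quotBaseChange : B ⊗[A] (MvPolynomial (Fin (n + 1)) A ⧸ I.toIdeal) ≃ₐ[B]
    MvPolynomial (Fin (n + 1)) B ⧸ (extendIdeal I B).toIdeal :=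
  (Algebra.TensorProduct.tensorQuotientEquiv (R := A) B _ B I.toIdeal).trans
    (Ideal.quotientEquivAlg _ _ (algebraTensorAlgEquiv A B) (by
      rw [toIdeal_extendIdeal]
      change _ = Ideal.map _ (Ideal.map
        (Algebra.TensorProduct.includeRight (R := A) (A := B)).toRingHom I.toIdeal)
      rw [Ideal.map_map]
      congr 1
      ext f : 1
      · ext a
        simp
      · simp))

theorem quotBaseChange_tmul_mk (b : B) (f : MvPolynomial (Fin (n + 1)) A) :
    quotBaseChange I B (b ⊗ₜ Ideal.Quotient.mk I.toIdeal f) =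
      b • Ideal.Quotient.mk (extendIdeal I B).toIdeal (map (algebraMap A B) f) := by
  change Ideal.Quotient.mk _ (algebraTensorAlgEquiv A B (b ⊗ₜ f)) = _
  rw [algebraTensorAlgEquiv_tmul]
  rfl

theorem quotBaseChange_baseChange_mem (d : ℕ) (x : B ⊗[A] quotGrading (stdGrading n A) I d) :
    quotBaseChange I B ((quotGrading (stdGrading n A) I d).subtype.baseChange B x) ∈
      quotGrading (stdGrading n B) (extendIdeal I B) d := by
  induction x with
  | zero => simp
  | add x y hx hy => rw [map_add, map_add]; exact add_mem hx hy
  | tmul b y =>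
    obtain ⟨_, f, hf, rfl⟩ := y
    have h := quotBaseChange_tmul_mk I B b f
    refine Set.mem_of_eq_of_mem h ?_
    exact Submodule.smul_mem _ _
      (mk_mem_quotGrading _ (MvPolynomial.IsHomogeneous.map hf (algebraMap A B)))

/-- The comparison map from the base change of a graded piece. -/
def quotGradingBaseChangeHom (d : ℕ) : B ⊗[A] quotGrading (stdGrading n A) I d →ₗ[B]
    quotGrading (stdGrading n B) (extendIdeal I B) d :=
  LinearMap.codRestrict _ ((quotBaseChange I B).toLinearMap ∘ₗ
    (quotGrading (stdGrading n A) I d).subtype.baseChange B) (quotBaseChange_baseChange_mem I B d)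

theorem coe_quotGradingBaseChangeHom_tmul {d : ℕ} (b : B) {f : MvPolynomial (Fin (n + 1)) A}
    (hf : f.IsHomogeneous d) :
    (quotGradingBaseChangeHom I B d (b ⊗ₜ ⟨_, mk_mem_quotGrading I hf⟩) :
      MvPolynomial (Fin (n + 1)) B ⧸ (extendIdeal I B).toIdeal) =
      b • Ideal.Quotient.mk (extendIdeal I B).toIdeal (map (algebraMap A B) f) :=
  quotBaseChange_tmul_mk I B b f

/-- Injectivity needs no flatness of `B`: a graded piece is a direct summand of the quotient ring.
Surjectivity holds because forms over `B` are combinations of monomials defined over `A`. -/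
theorem quotGradingBaseChangeHom_bijective (d : ℕ) :
    Function.Bijective (quotGradingBaseChangeHom I B d) := by
  constructor
  · let pr : (MvPolynomial (Fin (n + 1)) A ⧸ I.toIdeal) →ₗ[A] quotGrading (stdGrading n A) I d :=
      DirectSum.component A ℕ _ d ∘ₗ
        (DirectSum.decomposeLinearEquiv (quotGrading (stdGrading n A) I)).toLinearMap
    have hpr : pr ∘ₗ (quotGrading (stdGrading n A) I d).subtype = LinearMap.id := by
      ext1 x
      simp [pr, DirectSum.component.lof_self]
    have hinj : Function.Injective ((quotGrading (stdGrading n A) I d).subtype.baseChange B) := by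
      refine Function.LeftInverse.injective (g := pr.baseChange B) fun x => ?_
      rw [← LinearMap.comp_apply, ← LinearMap.baseChange_comp, hpr, LinearMap.baseChange_id]
      rfl
    intro x y hxy
    exact hinj ((quotBaseChange I B).injective (congrArg Subtype.val hxy))
  · rintro ⟨_, F, hF, rfl⟩
    have hmon : ∀ a ∈ F.support, (monomial a (1 : A)).IsHomogeneous d := fun a ha => by
      refine isHomogeneous_monomial _ ?_
      by_contra hne
      exact mem_support_iff.mp ha (IsHomogeneous.coeff_eq_zero hF hne)
    refine ⟨∑ a ∈ F.support.attach,
      F.coeff a ⊗ₜ ⟨_, mk_mem_quotGrading I (hmon a.1 a.2)⟩, Subtype.ext ?_⟩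
    rw [map_sum, AddSubmonoidClass.coe_finsetSum]
    have h1 : ∀ a : F.support, _ := fun a =>
      coe_quotGradingBaseChangeHom_tmul I B (F.coeff a.1) (hmon a.1 a.2)
    refine (Finset.sum_congr rfl fun a _ => h1 a).trans ?_
    simp only [map_monomial, map_one]
    rw [Finset.sum_attach F.support (fun a => F.coeff a •
      Ideal.Quotient.mk (extendIdeal I B).toIdeal (monomial a (1 : B)))]
    change _ = Ideal.Quotient.mk _ F
    conv_rhs => rw [F.as_sum, map_sum]
    refine Finset.sum_congr rfl fun a _ => ?_
    change Ideal.Quotient.mk _ (F.coeff a • monomial a (1 : B)) = _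
    rw [smul_monomial, smul_eq_mul, mul_one]

/-- Graded pieces of `S / I` commute with base change. -/
def quotGradingBaseChange (d : ℕ) : B ⊗[A] quotGrading (stdGrading n A) I d ≃ₗ[B]
    quotGrading (stdGrading n B) (extendIdeal I B) d :=
  LinearEquiv.ofBijective _ (quotGradingBaseChangeHom_bijective I B d)

theorem extendIdeal_extendIdeal (C : Type*) [CommRing C] [Algebra A C] [Algebra B C]
    [IsScalarTower A B C] : extendIdeal (extendIdeal I B) C = extendIdeal I C := by
  refine HomogeneousIdeal.ext ?_
  rw [toIdeal_extendIdeal, toIdeal_extendIdeal, toIdeal_extendIdeal, Ideal.map_map]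
  congr 1
  rw [IsScalarTower.algebraMap_eq A B C]
  exact RingHom.ext fun f => map_map _ _ f

end BaseChange

section Multiplication

variable {n : ℕ} {A : Type u} [CommRing A] (I : HomogeneousIdeal (stdGrading n A))
  {l : MvPolynomial (Fin (n + 1)) A} (hl : l.IsHomogeneous 1)

/-- Multiplication by the `k`-th power of a linear form on `S / I`. -/
def mulPow (k d : ℕ) :
    quotGrading (stdGrading n A) I d →ₗ[A] quotGrading (stdGrading n A) I (d + k) :=
  (LinearMap.mulLeft A (Ideal.Quotient.mk I.toIdeal (l ^ k))).restrict fun x hx => by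
    have h1 : (l ^ k).IsHomogeneous k := by simpa using hl.pow k
    have h2 := SetLike.GradedMul.mul_mem (A := quotGrading (stdGrading n A) I)
      (mk_mem_quotGrading I h1) hx
    rwa [add_comm k d] at h2

theorem coe_mulPow (k d : ℕ) (x : quotGrading (stdGrading n A) I d) :
    (mulPow I hl k d x : MvPolynomial (Fin (n + 1)) A ⧸ I.toIdeal) =
      Ideal.Quotient.mk I.toIdeal (l ^ k) * x :=
  rfl

theorem mulPow_injective {k d : ℕ}
    (h : ∀ e ≥ d, ∀ g : MvPolynomial (Fin (n + 1)) A, g.IsHomogeneous e →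
      l * g ∈ I.toIdeal → g ∈ I.toIdeal) : Function.Injective (mulPow I hl k d) := by
  have h1 : ∀ k, ∀ e ≥ d, ∀ g : MvPolynomial (Fin (n + 1)) A, g.IsHomogeneous e →
      l ^ k * g ∈ I.toIdeal → g ∈ I.toIdeal := by
    intro k
    induction k with
    | zero => simp
    | succ k ih =>
      intro e he g hg hlg
      refine h e he g hg (ih (1 + e) (by omega) _ (hl.mul hg) ?_)
      rwa [← mul_assoc, ← pow_succ]
  rw [injective_iff_map_eq_zero]
  rintro ⟨_, g, hg, rfl⟩ hx
  refine Subtype.ext (Ideal.Quotient.eq_zero_iff_mem.mpr (h1 k d le_rfl g hg ?_))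
  have := congrArg Subtype.val hx
  rw [coe_mulPow] at this
  refine Ideal.Quotient.eq_zero_iff_mem.mp ?_
  rw [map_mul]
  exact this

theorem mem_of_mulPow_injective {d : ℕ} (h : Function.Injective (mulPow I hl 1 d))
    {g : MvPolynomial (Fin (n + 1)) A} (hg : g.IsHomogeneous d) (hlg : l * g ∈ I.toIdeal) :
    g ∈ I.toIdeal := by
  refine Ideal.Quotient.eq_zero_iff_mem.mp (congrArg Subtype.val
    (h (a₁ := ⟨_, mk_mem_quotGrading I hg⟩) (a₂ := 0) ?_))
  refine Subtype.ext ?_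
  rw [coe_mulPow, pow_one, map_zero]
  change Ideal.Quotient.mk _ l * Ideal.Quotient.mk _ g = 0
  rw [← map_mul, Ideal.Quotient.eq_zero_iff_mem]
  exact hlg

variable (B : Type v) [CommRing B] [Algebra A B]

theorem quotGradingBaseChange_mulPow (k d : ℕ) (x : B ⊗[A] quotGrading (stdGrading n A) I d) :
    quotGradingBaseChange I B (d + k) ((mulPow I hl k d).baseChange B x) =
      mulPow (extendIdeal I B) (hl.map (algebraMap A B)) k d (quotGradingBaseChange I B d x) := by
  induction x with
  | zero => simp
  | add x y hx hy => simp only [map_add, hx, hy]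
  | tmul b y =>
    obtain ⟨_, f, hf, rfl⟩ := y
    refine Subtype.ext ?_
    rw [coe_mulPow]
    have h1 : (l ^ k * f).IsHomogeneous (d + k) := by
      have := (hl.pow k).mul hf
      rwa [one_mul, add_comm k d] at this
    have h2 := coe_quotGradingBaseChangeHom_tmul I B b h1
    have h3 := coe_quotGradingBaseChangeHom_tmul I B b hf
    refine h2.trans ?_
    refine Eq.trans ?_ (congrArg (_ * ·) h3).symm
    rw [map_mul, map_mul, map_pow, mul_smul_comm]

theorem baseChange_mulPow_injective_iff (k d : ℕ) :
    Function.Injective ((mulPow I hl k d).baseChange B) ↔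
      Function.Injective (mulPow (extendIdeal I B) (hl.map (algebraMap A B)) k d) := by
  have h : mulPow (extendIdeal I B) (hl.map (algebraMap A B)) k d ∘ quotGradingBaseChange I B d =
      quotGradingBaseChange I B (d + k) ∘ (mulPow I hl k d).baseChange B :=
    funext fun x => (quotGradingBaseChange_mulPow I hl B k d x).symm
  rw [← Function.Injective.of_comp_iff' _ (quotGradingBaseChange I B d).bijective, h,
    (quotGradingBaseChange I B (d + k)).injective.of_comp_iff]

end Multiplication

end BaseChangeResults

/-! ### Commutative algebra: localization, freeness and fibres -/

section LocalModulesResults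

open TensorProduct

/-- A submodule that becomes everything locally has the same localization. -/
theorem isLocalizedModule_comp_subtype {A M M' : Type*} [CommRing A] [AddCommGroup M]
    [Module A M] [AddCommGroup M'] [Module A M'] (g : M →ₗ[A] M') (S : Submonoid A) [IsLocalizedModule S g]
    (C : Submodule A M) (hC : ∀ b : M, ∃ s ∈ S, s • b ∈ C) :
    IsLocalizedModule S (g ∘ₗ C.subtype) where
  map_units := IsLocalizedModule.map_units g
  surj y := by
    obtain ⟨⟨b, t⟩, hb⟩ := IsLocalizedModule.surj S g y
    obtain ⟨s, hs, hsb⟩ := hC b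
    refine ⟨⟨⟨s • b, hsb⟩, ⟨s, hs⟩ * t⟩, ?_⟩
    change (s * (t : A)) • y = g (s • b)
    rw [map_smul, mul_smul]
    exact congrArg (s • ·) hb
  exists_of_eq {x y} hxy := by
    obtain ⟨c, hc⟩ := IsLocalizedModule.exists_of_eq (S := S) (f := g) hxy
    exact ⟨c, Subtype.ext hc⟩

section LocalFreeness

variable {A : Type*} [CommRing A] (p : Ideal A) [p.IsPrime]
  {O : Type*} [CommRing O] [Algebra A O] [IsLocalization.AtPrime O p]
  (L : Type*) [Field L] [Algebra A L] [Algebra O L] [IsScalarTower A O L]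
  {M M' : Type*} [AddCommGroup M] [Module A M] [AddCommGroup M'] [Module A M'] [Module O M']
  [IsScalarTower A O M']

/-- Base change to an algebra over the local ring factors through localization. -/
def baseChangeEquivOfIsLocalizedModule (g : M →ₗ[A] M') [IsLocalizedModule p.primeCompl g] :
    L ⊗[A] M ≃ₗ[L] L ⊗[O] M' :=
  (AlgebraTensorModule.cancelBaseChange A O L L M).symm ≪≫ₗ
    AlgebraTensorModule.congr (LinearEquiv.refl L L)
      ((isLocalizedModule_iff_isBaseChange p.primeCompl O g).mp inferInstance).equiv

theorem finite_and_finrank_of_free_localization (g : M →ₗ[A] M') [IsLocalizedModule p.primeCompl g]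
    {r : ℕ} [Module.Free O M']
    (hr : Module.rank O M' = r) :
    Module.Finite L (L ⊗[A] M) ∧ Module.finrank L (L ⊗[A] M) = r := by
  have : IsLocalRing O := IsLocalization.AtPrime.isLocalRing O p
  have : Module.Finite O M' := Module.rank_lt_aleph0_iff.mp (hr ▸ Cardinal.natCast_lt_aleph0)
  let e := baseChangeEquivOfIsLocalizedModule (O := O) p L g
  refine ⟨Module.Finite.equiv e.symm, ?_⟩
  rw [e.finrank_eq, Module.finrank_baseChange, Module.finrank, hr, Cardinal.toNat_natCast]

/-- The range of `ψ` localizes to `M'`, which is thus finite and flat over a local ring, hence free.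
The auxiliary map `v` factors through that range, so its injectivity over `L` identifies the fibre
of the range with that of `C₀`, which gives the rank. -/
theorem free_localization_of_range (g : M →ₗ[A] M') [IsLocalizedModule p.primeCompl g]
    {C₀ C₁ : Type*} [AddCommGroup C₀] [Module A C₀]
    [Module.Finite A C₀] [AddCommGroup C₁] [Module A C₁] [Module.Flat A M] (ψ : C₀ →ₗ[A] M)
    (hψ : ∀ b : M, ∃ s ∈ p.primeCompl, s • b ∈ LinearMap.range ψ) (v : C₀ →ₗ[A] C₁)
    (hv : LinearMap.ker ψ ≤ LinearMap.ker v) (hvL : Function.Injective (v.baseChange L)) :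
    Module.Free O M' ∧ Module.rank O M' = Module.finrank L (L ⊗[A] C₀) := by
  have : IsLocalRing O := IsLocalization.AtPrime.isLocalRing O p
  let C := LinearMap.range ψ
  have : IsLocalizedModule p.primeCompl (g ∘ₗ C.subtype) :=
    isLocalizedModule_comp_subtype g p.primeCompl C hψ
  have : Module.Finite O M' := Module.Finite.of_isLocalizedModule p.primeCompl (g ∘ₗ C.subtype)
  have : Module.Flat O M' := Module.Flat.of_isLocalizedModule O p.primeCompl g
  have hfree : Module.Free O M' := Module.free_of_flat_of_isLocalRing
  refine ⟨hfree, ?_⟩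
  have hfac : v = ((LinearMap.ker ψ).liftQ v hv ∘ₗ ψ.quotKerEquivRange.symm.toLinearMap) ∘ₗ
      ψ.rangeRestrict := by
    ext x
    have : ψ.quotKerEquivRange.symm (ψ.rangeRestrict x) = Submodule.Quotient.mk x := by
      rw [LinearEquiv.symm_apply_eq]
      rfl
    simp [this]
  have hbij : Function.Bijective (ψ.rangeRestrict.baseChange L) := by
    constructor
    · rw [hfac, LinearMap.baseChange_comp] at hvL
      exact Function.Injective.of_comp hvL
    · exact LinearMap.lTensor_surjective L ψ.surjective_rangeRestrict
  have h1 := (finite_and_finrank_of_free_localization p L (g ∘ₗ C.subtype)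
    (Module.finrank_eq_rank O M').symm).2
  rw [(LinearEquiv.ofBijective _ hbij).finrank_eq, h1, Module.finrank_eq_rank]

end LocalFreeness

section ResidueField

variable {A : Type*} [CommRing A] (p : PrimeSpectrum A) (L : Type*) [Field L] [Algebra A L]
  [Algebra p.asIdeal.ResidueField L] [IsScalarTower A p.asIdeal.ResidueField L]
  {C₀ C₁ : Type*} [AddCommGroup C₀] [Module A C₀] [AddCommGroup C₁] [Module A C₁]
  [Module.Finite A C₁]

/-- Nakayama for the cokernel: its fibre over `L` vanishes, so by faithful flatness does the one
over the residue field, and `p` is outside its support. As it is finite, one `s` outside `p`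
annihilates it. -/
theorem exists_smul_mem_range_of_baseChange_surjective (w : C₀ →ₗ[A] C₁)
    (hw : Function.Surjective (w.baseChange L)) :
    ∃ s ∈ p.asIdeal.primeCompl, ∀ y : C₁, s • y ∈ LinearMap.range w := by
  let κ := p.asIdeal.ResidueField
  let Q := C₁ ⧸ LinearMap.range w
  have hzero : (LinearMap.range w).mkQ.baseChange L ∘ₗ w.baseChange L = 0 := by
    rw [← LinearMap.baseChange_comp, LinearMap.range_mkQ_comp, LinearMap.baseChange_zero]
  have hsurj : Function.Surjective ((LinearMap.range w).mkQ.baseChange L) :=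
    LinearMap.lTensor_surjective L (Submodule.mkQ_surjective _)
  have h1 : Subsingleton (L ⊗[A] Q) := by
    refine subsingleton_of_forall_eq 0 fun z => ?_
    obtain ⟨y, rfl⟩ := hsurj z
    obtain ⟨x, rfl⟩ := hw y
    exact LinearMap.congr_fun hzero x
  have h2 : Subsingleton (κ ⊗[A] Q) := by
    by_contra hns
    rw [not_subsingleton_iff_nontrivial] at hns
    have h3 : Nontrivial (L ⊗[κ] (κ ⊗[A] Q)) := Module.FaithfullyFlat.lTensor_nontrivial κ L _
    have h4 := (AlgebraTensorModule.cancelBaseChange A κ L L Q).symm.toEquiv.nontrivial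
    exact not_subsingleton (L ⊗[A] Q) h1
  have h5 : p ∉ Module.support A Q := by
    rw [Module.mem_support_iff_nontrivial_residueField_tensorProduct]
    exact not_nontrivial_iff_subsingleton.mpr h2
  rw [Module.mem_support_iff_of_finite, SetLike.not_le_iff_exists] at h5
  obtain ⟨s, hs, hsp⟩ := h5
  refine ⟨s, hsp, fun y => ?_⟩
  rw [← Submodule.Quotient.mk_eq_zero, Submodule.Quotient.mk_smul]
  exact Module.mem_annihilator.mp hs _

end ResidueField

section DirectedSystem

variable {A : Type*} [CommRing A] (L : Type*) [Field L] [Algebra A L]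
  {R : ℕ → Type*} [∀ d, AddCommGroup (R d)] [∀ d, Module A (R d)] [∀ d, Module.Finite A (R d)]
  {M : Type*} [AddCommGroup M] [Module A M] (v : ∀ d, R d →ₗ[A] R (d + 1))
  (ψ : ∀ d, R d →ₗ[A] M)

/-- The images of `L ⊗ R d` increase and exhaust a finite-dimensional space, so they stabilize at
the whole of it. Equal dimensions then make `ψ d` bijective over `L`, and it factors through `v d`.
-/
theorem eventually_baseChange_injective (hψ : ∀ d, ψ (d + 1) ∘ₗ v d = ψ d)
    (hsurj : ∀ b, ∃ d x, ψ d x = b) [Module.Finite L (L ⊗[A] M)]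
    (hdim : ∀ᶠ d in Filter.atTop, Module.finrank L (L ⊗[A] R d) = Module.finrank L (L ⊗[A] M)) :
    ∀ᶠ d in Filter.atTop, Function.Injective ((v d).baseChange L) := by
  have hψL : ∀ d, (ψ (d + 1)).baseChange L ∘ₗ (v d).baseChange L = (ψ d).baseChange L := fun d => by
    rw [← LinearMap.baseChange_comp, hψ]
  let W : ℕ →o Submodule L (L ⊗[A] M) :=
    ⟨fun d => LinearMap.range ((ψ d).baseChange L), monotone_nat_of_le_succ fun d => by
      rw [← hψL d]; exact LinearMap.range_comp_le_range _ _⟩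
  obtain ⟨d₁, hd₁⟩ := monotone_stabilizes_iff_noetherian.mpr
    (inferInstance : IsNoetherian L (L ⊗[A] M)) W
  have htop : W d₁ = ⊤ := by
    refine eq_top_iff.mpr fun z _ => ?_
    induction z with
    | zero => exact zero_mem _
    | add x y hx hy => exact add_mem (hx trivial) (hy trivial)
    | tmul a b =>
      obtain ⟨d, x, rfl⟩ := hsurj b
      have h1 : a ⊗ₜ ψ d x ∈ W d := ⟨a ⊗ₜ x, rfl⟩
      rcases le_total d₁ d with h | h
      · rw [hd₁ d h]; exact h1
      · exact W.monotone h h1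
  filter_upwards [hdim, Filter.eventually_ge_atTop d₁] with d hd hdd
  have h1 : Function.Surjective ((ψ d).baseChange L) :=
    LinearMap.range_eq_top.mp ((hd₁ d hdd).symm.trans htop)
  have h2 := (LinearMap.injective_iff_surjective_of_finrank_eq_finrank hd).mpr h1
  rw [← hψL] at h2
  exact Function.Injective.of_comp h2

end DirectedSystem

end LocalModulesResults

/-! ### Stalks of direct images as localized modules -/

section Pushforward

/-- Composing with an isomorphism on the source does not change the direct image. -/
theorem exists_pushforwardStalk_equiv {U Z X : Scheme.{u}} (e : U ⟶ Z) [IsIso e] (f : Z ⟶ X) (x : X) :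
    ∃ φ : pushforwardStalk f x ≃+* pushforwardStalk (e ≫ f) x,
      ∀ a, φ (algebraMap (X.presheaf.stalk x) _ a) = algebraMap (X.presheaf.stalk x) _ a := by
  have : IsIso e.c := inferInstance
  let α := (TopCat.Presheaf.stalkFunctor CommRingCat x).map
    ((TopCat.Presheaf.pushforward CommRingCat f.base).map e.c)
  have : IsIso α := inferInstance
  refine ⟨(asIso α).commRingCatIsoToRingEquiv, fun a => ?_⟩
  change ((TopCat.Presheaf.stalkFunctor CommRingCat x).map f.c ≫ α).hom a = _
  rw [← Functor.map_comp]
  rfl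

theorem pushforwardStalkFreeOfRank_comp_iff {U Z X : Scheme.{u}} (e : U ⟶ Z) [IsIso e] (f : Z ⟶ X)
    (x : X) (r : ℕ) :
    PushforwardStalkFreeOfRank (e ≫ f) x r ↔ PushforwardStalkFreeOfRank f x r := by
  obtain ⟨φ, hφ⟩ := exists_pushforwardStalk_equiv e f x
  let ψ : pushforwardStalk f x ≃ₗ[X.presheaf.stalk x] pushforwardStalk (e ≫ f) x :=
    (AlgEquiv.ofRingEquiv (f := φ) hφ).toLinearEquiv
  rw [PushforwardStalkFreeOfRank, PushforwardStalkFreeOfRank, ψ.rank_eq, Module.Free.iff_of_equiv ψ]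

variable (A B : Type u) [CommRing A] [CommRing B] [Algebra A B] (p : PrimeSpectrum A)

/-- The stalk at `p` of the structure sheaf of `Spec A`. -/
abbrev specStalk : CommRingCat.{u} := (Spec (CommRingCat.of A)).presheaf.stalk p

instance specStalk_algebra : Algebra A (specStalk A p) :=
  inferInstanceAs (Algebra A ((Spec.structureSheaf A).presheaf.stalk p))

instance specStalk_isLocalization : IsLocalization.AtPrime (specStalk A p) p.asIdeal :=
  inferInstanceAs (IsLocalization.AtPrime ((Spec.structureSheaf A).presheaf.stalk p) p.asIdeal)

/-- The stalk at `p` of the direct image of the structure sheaf of `Spec B`. -/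
abbrev specMapStalk : CommRingCat.{u} :=
  pushforwardStalk (Spec.map (CommRingCat.ofHom (algebraMap A B))) p

instance specMapStalk_algebra' : Algebra (specStalk A p) (specMapStalk A B p) :=
  pushforwardStalk_algebra (Spec.map (CommRingCat.ofHom (algebraMap A B))) p

instance specMapStalk_algebra : Algebra A (specMapStalk A B p) :=
  (CommRingCat.ofHom (algebraMap A B) ≫
    StructureSheaf.toPushforwardStalk (CommRingCat.ofHom (algebraMap A B)) p).hom.toAlgebra

/-- The `A`-structures through `B` and through the local ring at `p` agree by naturality. -/
instance : IsScalarTower A (specStalk A p) (specMapStalk A B p) :=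
  IsScalarTower.of_algebraMap_eq' (congrArg CommRingCat.Hom.hom
    (StructureSheaf.toPushforwardStalk_comp (CommRingCat.ofHom (algebraMap A B)) p))

/-- The canonical map from `B` to the stalk at `p` of the direct image of its structure sheaf. -/
def toSpecMapStalk : B →ₗ[A] specMapStalk A B p :=
  AlgHom.toLinearMap
    { (StructureSheaf.toPushforwardStalk (CommRingCat.ofHom (algebraMap A B)) p).hom with
      commutes' := fun _ => rfl }

instance isLocalizedModule_toSpecMapStalk :
    IsLocalizedModule p.asIdeal.primeCompl (toSpecMapStalk A B p) := by
  have h := StructureSheaf.isLocalizedModule_toPushforwardStalkAlgHom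
    (CommRingCat.of A) (CommRingCat.of B) p
  exact h

end Pushforward

/-! ### The coordinate ring of the nonvanishing locus as a colimit of graded pieces -/

section AffineChart

open HomogeneousLocalization MvPolynomial

variable {n : ℕ} {A : Type u} [CommRing A] (I : HomogeneousIdeal (stdGrading n A))
  {l : MvPolynomial (Fin (n + 1)) A} (hl : l.IsHomogeneous 1)

variable (l) in
/-- The degree-zero part of the localization of `S / I` at `l`: the coordinate ring of `D₊(l)`. -/
def ChartRing : Type u := Away (quotGrading (stdGrading n A) I) (Ideal.Quotient.mk I.toIdeal l)

instance : CommRing (ChartRing I l) :=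
  inferInstanceAs (CommRing (Away (quotGrading (stdGrading n A) I) (Ideal.Quotient.mk I.toIdeal l)))

instance : Algebra A (ChartRing I l) :=
  ((fromZeroRingHom (quotGrading (stdGrading n A) I)
    (Submonoid.powers (Ideal.Quotient.mk I.toIdeal l))).comp
      (algebraMap A (quotGrading (stdGrading n A) I 0))).toAlgebra

/-- The isomorphism of `D₊(l)` with the spectrum of its coordinate ring. -/
def chartIso : (nonvanishingLocus I l).toScheme ≅ Spec (CommRingCat.of (ChartRing I l)) :=
  Proj.basicOpenIsoSpec (quotGrading (stdGrading n A) I) (Ideal.Quotient.mk I.toIdeal l)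
    (mk_mem_quotGrading I hl) one_pos

theorem chartIso_inv_comp :
    (chartIso I hl).inv ≫ (nonvanishingLocus I l).ι ≫ projQuotToSpec I =
      Spec.map (CommRingCat.ofHom (algebraMap A (ChartRing I l))) := by
  have h1 := Proj.basicOpenIsoSpec_inv_ι (quotGrading (stdGrading n A) I)
    (Ideal.Quotient.mk I.toIdeal l) (mk_mem_quotGrading I hl) one_pos
  have h2 := Proj.awayι_toSpecZero (quotGrading (stdGrading n A) I)
    (Ideal.Quotient.mk I.toIdeal l) (mk_mem_quotGrading I hl) one_pos
  change (Proj.basicOpenIsoSpec (quotGrading (stdGrading n A) I) (Ideal.Quotient.mk I.toIdeal l)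
    (mk_mem_quotGrading I hl) one_pos).inv ≫ (Proj.basicOpen _ _).ι ≫ projQuotToSpec I = _
  rw [projQuotToSpec, reassoc_of% h1, reassoc_of% h2, ← Spec.map_comp]
  rfl

theorem nonvanishingLocus_ι_comp_projQuotToSpec :
    (nonvanishingLocus I l).ι ≫ projQuotToSpec I =
      (chartIso I hl).hom ≫ Spec.map (CommRingCat.ofHom (algebraMap A (ChartRing I l))) := by
  rw [← Iso.inv_comp_eq, chartIso_inv_comp]

/-- Restricting a flat morphism to an open subscheme keeps it flat, and between affine schemes this
is flatness of the ring map. -/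
theorem chartRing_flat (hI : Flat (projQuotToSpec I)) (hl : l.IsHomogeneous 1) :
    Module.Flat A (ChartRing I l) := by
  have h2 : Flat (Spec.map (CommRingCat.ofHom (algebraMap A (ChartRing I l)))) := by
    rw [← chartIso_inv_comp I hl]
    infer_instance
  rw [Flat.SpecMap_iff] at h2
  exact RingHom.flat_algebraMap_iff.mp h2

/-- The embedding of the coordinate ring of `D₊(l)` into the localization of `S / I` at `l`. -/
def chartVal : ChartRing I l →+* Localization (Submonoid.powers (Ideal.Quotient.mk I.toIdeal l)) :=
  algebraMap (Away (quotGrading (stdGrading n A) I) (Ideal.Quotient.mk I.toIdeal l)) _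

theorem chartVal_injective : Function.Injective (chartVal I (l := l)) :=
  HomogeneousLocalization.val_injective _

theorem chartVal_algebraMap (a : A) :
    chartVal I (algebraMap A (ChartRing I l) a) = Localization.mk (algebraMap A _ a) 1 :=
  rfl

/-- The fraction `r / l ^ d`. -/
def chartFrac (d : ℕ) (r : quotGrading (stdGrading n A) I d) : ChartRing I l :=
  Away.mk (quotGrading (stdGrading n A) I) (mk_mem_quotGrading I hl) d r.1 (by simp)

theorem chartVal_chartFrac (d : ℕ) (r : quotGrading (stdGrading n A) I d) :
    chartVal I (chartFrac I hl d r) =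
      Localization.mk r.1 (⟨Ideal.Quotient.mk I.toIdeal l ^ d, ⟨d, rfl⟩⟩ :
        Submonoid.powers (Ideal.Quotient.mk I.toIdeal l)) :=
  rfl

/-- The map `r ↦ r / l ^ d` from the degree-`d` part of `S / I`. -/
def toChartRing (d : ℕ) : quotGrading (stdGrading n A) I d →ₗ[A] ChartRing I l where
  toFun r := chartFrac I hl d r
  map_add' r s := by
    apply chartVal_injective I
    rw [map_add, chartVal_chartFrac, chartVal_chartFrac, chartVal_chartFrac,
      Localization.add_mk_self]
    rfl
  map_smul' a r := by
    apply chartVal_injective I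
    rw [RingHom.id_apply, Algebra.smul_def, map_mul, chartVal_chartFrac, chartVal_chartFrac,
      chartVal_algebraMap, Localization.mk_mul, one_mul, ← Algebra.smul_def]
    rfl

theorem chartVal_toChartRing (d : ℕ) (r : quotGrading (stdGrading n A) I d) :
    chartVal I (toChartRing I hl d r) =
      Localization.mk r.1 (⟨Ideal.Quotient.mk I.toIdeal l ^ d, ⟨d, rfl⟩⟩ :
        Submonoid.powers (Ideal.Quotient.mk I.toIdeal l)) :=
  rfl

/-- Together with `exists_toChartRing_eq` and `exists_mulPow_eq_zero`, this exhibits the chart ring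
as the colimit of the graded pieces along multiplication by `l`. -/
theorem toChartRing_mulPow (k d : ℕ) (r : quotGrading (stdGrading n A) I d) :
    toChartRing I hl (d + k) (mulPow I hl k d r) = toChartRing I hl d r := by
  apply chartVal_injective I
  rw [chartVal_toChartRing, chartVal_toChartRing, coe_mulPow, Localization.mk_eq_mk_iff,
    Localization.r_iff_exists]
  refine ⟨1, ?_⟩
  simp only [OneMemClass.coe_one, one_mul, map_pow]
  ring

theorem exists_toChartRing_eq (b : ChartRing I l) : ∃ d r, toChartRing I hl d r = b := by
  obtain ⟨d, r, hr, h⟩ := Away.mk_surjective (quotGrading (stdGrading n A) I)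
    (mk_mem_quotGrading I hl) b
  exact ⟨d, ⟨r, by simpa using hr⟩, h⟩

theorem exists_mulPow_eq_zero {d : ℕ} {r : quotGrading (stdGrading n A) I d}
    (h : toChartRing I hl d r = 0) : ∃ k, mulPow I hl k d r = 0 := by
  have h1 := congrArg (chartVal I) h
  rw [chartVal_toChartRing, map_zero, ← Localization.mk_zero 1, Localization.mk_eq_mk_iff,
    Localization.r_iff_exists] at h1
  obtain ⟨⟨_, k, rfl⟩, hk⟩ := h1
  refine ⟨k, Subtype.ext ?_⟩
  rw [coe_mulPow]
  simpa using hk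

/-- `S / I` is generated in degree one: if `s` maps degree `e + 1` into the multiples of `l`, then it
does so in all larger degrees. -/
theorem smul_mem_range_mulPow_succ {e : ℕ} {s : A}
    (hs : ∀ y, s • y ∈ LinearMap.range (mulPow I hl 1 e))
    (y : quotGrading (stdGrading n A) I (e + 1 + 1)) :
    s • y ∈ LinearMap.range (mulPow I hl 1 (e + 1)) := by
  suffices H : s • y.1 ∈ (LinearMap.range (mulPow I hl 1 (e + 1))).map
      (quotGrading (stdGrading n A) I (e + 1 + 1)).subtype by
    obtain ⟨z, hz, hzy⟩ := H
    rwa [← show z = s • y from Subtype.ext hzy]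
  obtain ⟨_, f, hf, rfl⟩ := y
  change s • Ideal.Quotient.mk I.toIdeal f ∈ _
  rw [f.as_sum, map_sum, Finset.smul_sum]
  refine sum_mem fun a ha => ?_
  have hdeg : a.degree = e + 1 + 1 := by
    by_contra hne
    exact mem_support_iff.mp ha (IsHomogeneous.coeff_eq_zero hf hne)
  obtain ⟨i, hi⟩ : ∃ i, a i ≠ 0 := by
    by_contra! h0
    rw [show a = 0 from Finsupp.ext h0] at hdeg
    simp at hdeg
  -- Peel one variable off the monomial, apply `hs` to the remaining factor of degree `e + 1`, and
  -- multiply the preimage by that variable.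
  obtain ⟨b, rfl⟩ : ∃ b, a = Finsupp.single i 1 + b :=
    le_iff_exists_add.mp (Finsupp.single_le_iff.mpr (Nat.one_le_iff_ne_zero.mpr hi))
  have hb : b.degree = e + 1 := by
    rw [map_add, Finsupp.degree_single] at hdeg
    omega
  generalize coeff (Finsupp.single i 1 + b) f = c
  have hbm : (monomial b c).IsHomogeneous (e + 1) := isHomogeneous_monomial _ hb
  obtain ⟨z, hz⟩ := hs ⟨_, mk_mem_quotGrading I hbm⟩
  have hz' : Ideal.Quotient.mk I.toIdeal (l ^ 1) * z.1 =
      s • Ideal.Quotient.mk I.toIdeal (monomial b c) := congrArg Subtype.val hz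
  have hX : Ideal.Quotient.mk I.toIdeal (X i) * z.1 ∈ quotGrading (stdGrading n A) I (e + 1) := by
    have := SetLike.GradedMul.mul_mem (A := quotGrading (stdGrading n A) I)
      (mk_mem_quotGrading I (isHomogeneous_X A i)) z.2
    rwa [add_comm 1 e] at this
  refine ⟨_, ⟨⟨_, hX⟩, rfl⟩, ?_⟩
  rw [Submodule.subtype_apply, coe_mulPow, mul_left_comm, hz', mul_smul_comm, ← map_mul,
    X, monomial_mul, one_mul]

theorem mulPow_eq_zero_of_le {k k' d : ℕ} (hkk : k ≤ k') {r : quotGrading (stdGrading n A) I d}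
    (h : mulPow I hl k d r = 0) : mulPow I hl k' d r = 0 := by
  refine Subtype.ext ?_
  have h1 : Ideal.Quotient.mk I.toIdeal (l ^ k) * r.1 = 0 := congrArg Subtype.val h
  rw [coe_mulPow, ← Nat.sub_add_cancel hkk, pow_add, map_mul, mul_assoc, h1, mul_zero]
  rfl

/-- A single power of `l` kills the kernel of `r ↦ r / l ^ d`. -/
theorem exists_ker_toChartRing_le [IsNoetherianRing A] (d : ℕ) :
    ∃ k, LinearMap.ker (toChartRing I hl d) ≤ LinearMap.ker (mulPow I hl k d) := by
  obtain ⟨G, hG⟩ := IsNoetherian.noetherian (LinearMap.ker (toChartRing I hl d))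
  have h1 : ∀ g : G, ∃ k, mulPow I hl k d g = 0 := fun g => by
    have : g.1 ∈ LinearMap.ker (toChartRing I hl d) := hG ▸ Submodule.subset_span g.2
    exact exists_mulPow_eq_zero I hl this
  choose k hk using h1
  refine ⟨Finset.univ.sup k, ?_⟩
  rw [← hG, Submodule.span_le]
  exact fun g hg => mulPow_eq_zero_of_le I hl (Finset.le_sup (Finset.mem_univ _)) (hk ⟨g, hg⟩)

/-- If `s` maps degree `d + 1` into the multiples of `l`, then all of the coordinate ring of
`D₊(l)` is, up to powers of `s`, given by fractions with denominator `l ^ d`. -/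
theorem exists_smul_mem_range_toChartRing {d : ℕ} {s : A}
    (hs : ∀ y, s • y ∈ LinearMap.range (mulPow I hl 1 d)) (b : ChartRing I l) :
    ∃ m, s ^ m • b ∈ LinearMap.range (toChartRing I hl d) := by
  have hgen : ∀ k, ∀ y : quotGrading (stdGrading n A) I (d + k + 1),
      s • y ∈ LinearMap.range (mulPow I hl 1 (d + k)) := by
    intro k
    induction k with
    | zero => exact hs
    | succ k ih => exact smul_mem_range_mulPow_succ I hl ih
  -- Each factor `s` cancels one power of `l` from the denominator.
  have hdown : ∀ k (r : quotGrading (stdGrading n A) I (d + k)),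
      s ^ k • toChartRing I hl (d + k) r ∈ LinearMap.range (toChartRing I hl d) := by
    intro k
    induction k with
    | zero => intro r; simp
    | succ k ih =>
      intro r
      obtain ⟨r', hr'⟩ := hgen k r
      have : s • toChartRing I hl (d + (k + 1)) r = toChartRing I hl (d + k) r' := by
        rw [← map_smul, ← toChartRing_mulPow I hl 1 (d + k) r', hr']
        rfl
      rw [pow_succ, mul_smul, this]
      exact ih r'
  obtain ⟨e, r, rfl⟩ := exists_toChartRing_eq I hl b
  -- Rewriting `r / l ^ e` with denominator `l ^ (e + d)` puts it exactly `e` steps above `d`,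
  -- whence the exponent; `N` absorbs the change from `e + d` to `d + e`.
  refine ⟨e, ?_⟩
  rw [← toChartRing_mulPow I hl d e r]
  have h1 : ∀ N, N = d + e → ∀ r : quotGrading (stdGrading n A) I N,
      s ^ e • toChartRing I hl N r ∈ LinearMap.range (toChartRing I hl d) := by
    rintro N rfl r
    exact hdown e r
  exact h1 _ (add_comm _ _) _

end AffineChart

/-! ### The freeness criterion and the theorem -/

section Main

open MvPolynomial Filter
open scoped TensorProduct

theorem vanishesAt_iff {K : Type*} [CommRing K] {L : Type*} [Field L] [Algebra K L] {n : ℕ}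
    {u : MvPolynomial (Fin (n + 1)) K} (hu : u.IsHomogeneous 1) (P : ℙ L (Fin (n + 1) → L)) :
    VanishesAt u P ↔ map (algebraMap K L) u ∈ pointIdeal P := by
  rw [mem_pointIdeal_iff (hu.map _), VanishesAt, MvPolynomial.eval_map]
  rfl

variable {n : ℕ} {A : Type u} [CommRing A] (I : HomogeneousIdeal (stdGrading n A))

theorem geometricFiberIdeal_eq (p : PrimeSpectrum A) :
    geometricFiberIdeal I p = extendIdeal I (AlgebraicClosure p.asIdeal.ResidueField) :=
  extendIdeal_extendIdeal I _ _

/-- Extending the residue field to its algebraic closure preserves the dimensions of graded pieces.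
-/
theorem eventually_finrank_geometricFiber {μ : ℕ} (hI : IsHilbFamily I μ) (p : PrimeSpectrum A) :
    ∀ᶠ d in atTop, Module.finrank (AlgebraicClosure p.asIdeal.ResidueField)
      (quotGrading (stdGrading n (AlgebraicClosure p.asIdeal.ResidueField))
        (extendIdeal I (AlgebraicClosure p.asIdeal.ResidueField)) d) = μ := by
  filter_upwards [hI.hilbertPolynomial p] with d hd
  rw [Polynomial.eval_C, Nat.cast_inj] at hd
  rw [← geometricFiberIdeal_eq, ← (quotGradingBaseChange _ _ d).finrank_eq,
    Module.finrank_baseChange, hd]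

theorem eventually_finrank_tensor {μ : ℕ} (hI : IsHilbFamily I μ) (p : PrimeSpectrum A) :
    ∀ᶠ d in atTop, Module.finrank (AlgebraicClosure p.asIdeal.ResidueField)
      (AlgebraicClosure p.asIdeal.ResidueField ⊗[A] quotGrading (stdGrading n A) I d) = μ := by
  filter_upwards [eventually_finrank_geometricFiber I hI p] with d hd
  rw [(quotGradingBaseChange I _ d).finrank_eq, hd]

theorem pushforwardStalkFreeOfRank_iff [IsNoetherianRing A] {μ : ℕ} (hI : IsHilbFamily I μ)
    {l : MvPolynomial (Fin (n + 1)) A} (hl : l.IsHomogeneous 1) (p : PrimeSpectrum A) :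
    PushforwardStalkFreeOfRank ((nonvanishingLocus I l).ι ≫ projQuotToSpec I) p μ ↔
      ∃ d₀, ∀ d ≥ d₀, ∀ g : MvPolynomial (Fin (n + 1)) (AlgebraicClosure p.asIdeal.ResidueField),
        g.IsHomogeneous d →
          map (algebraMap A _) l * g ∈
            (extendIdeal I (AlgebraicClosure p.asIdeal.ResidueField)).toIdeal →
          g ∈ (extendIdeal I (AlgebraicClosure p.asIdeal.ResidueField)).toIdeal := by
  let L := AlgebraicClosure p.asIdeal.ResidueField
  let O := specStalk A p
  -- Elements outside `p` become units in `L`, so `L` is an algebra over the local ring at `p`.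
  have hunit : ∀ y : p.asIdeal.primeCompl, IsUnit (algebraMap A L y) := fun y => by
    rw [isUnit_iff_ne_zero, IsScalarTower.algebraMap_apply A p.asIdeal.ResidueField L, Ne,
      map_eq_zero, Ideal.algebraMap_residueField_eq_zero]
    exact y.2
  let _ : Algebra O L := (IsLocalization.lift (M := p.asIdeal.primeCompl) hunit).toAlgebra
  have : IsScalarTower A O L :=
    IsScalarTower.of_algebraMap_eq fun x => (IsLocalization.lift_eq hunit x).symm
  rw [nonvanishingLocus_ι_comp_projQuotToSpec I hl]
  refine (pushforwardStalkFreeOfRank_comp_iff (chartIso I hl).hom _ _ μ).trans ?_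
  have hdim : ∀ᶠ d in atTop, Module.finrank L (L ⊗[A] quotGrading (stdGrading n A) I d) = μ :=
    eventually_finrank_tensor I hI p
  constructor
  · rintro ⟨hfree, hrank⟩
    have : Module.Free O (specMapStalk A (ChartRing I l) p) := hfree
    obtain ⟨hfin, hr⟩ := finite_and_finrank_of_free_localization (O := O) p.asIdeal L
      (toSpecMapStalk A (ChartRing I l) p) hrank
    have h1 := eventually_baseChange_injective L (M := ChartRing I l)
      (fun d => mulPow I hl 1 d) (fun d => toChartRing I hl d)
      (fun d => LinearMap.ext (toChartRing_mulPow I hl 1 d)) (exists_toChartRing_eq I hl)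
      (hdim.mono fun d hd => hd.trans hr.symm)
    obtain ⟨d₀, hd₀⟩ := eventually_atTop.mp h1
    refine ⟨d₀, fun d hd g hg hlg => ?_⟩
    exact mem_of_mulPow_injective _ (hl.map (algebraMap A L))
      ((baseChange_mulPow_injective_iff I hl L 1 d).mp (hd₀ d hd)) hg hlg
  · rintro ⟨d₀, hd₀⟩
    have hinj : ∀ d ≥ d₀, ∀ k, Function.Injective ((mulPow I hl k d).baseChange L) :=
      fun d hd k => (baseChange_mulPow_injective_iff I hl L k d).mpr
        (mulPow_injective _ _ fun e he => hd₀ e (hd.trans he))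
    -- Both degrees `d` and `d + 1` must have fibre dimension `μ`, so that injectivity of
    -- multiplication by `l` gives surjectivity.
    obtain ⟨d, hd, hd1, hdd⟩ := (hdim.and
      (((tendsto_add_atTop_nat 1).eventually hdim).and (eventually_ge_atTop d₀))).exists
    have hsurj : Function.Surjective ((mulPow I hl 1 d).baseChange L) :=
      (LinearMap.injective_iff_surjective_of_finrank_eq_finrank (hd.trans hd1.symm)).mp
        (hinj d hdd 1)
    obtain ⟨s, hs, hsy⟩ := exists_smul_mem_range_of_baseChange_surjective p L _ hsurj
    obtain ⟨k, hk⟩ := exists_ker_toChartRing_le I hl d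
    have : Module.Flat A (ChartRing I l) := chartRing_flat I hI.flat hl
    -- The map `v` is multiplication by `l ^ k`: it kills the kernel of `R_d → B` by `hk`, yet is
    -- injective over `L`.
    have h2 := free_localization_of_range (O := O) p.asIdeal L (toSpecMapStalk A (ChartRing I l) p)
      (toChartRing I hl d)
      (fun b => by
        obtain ⟨m, hm⟩ := exists_smul_mem_range_toChartRing I hl hsy b
        exact ⟨s ^ m, pow_mem hs m, hm⟩)
      (mulPow I hl k d) hk (hinj d hdd k)
    rw [hd] at h2
    exact h2

end Main

end PunctualHilbert

end

open PunctualHilbert in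
theorem mainTheorem9 {K : Type*} [Field K] [IsAlgClosed K] [CharZero K]
    {A : Type*} [CommRing A] [IsNoetherianRing A] [Algebra K A]
    (n μ : ℕ) (I : HomogeneousIdeal (stdGrading n A)) (hI : IsHilbFamily I μ)
    (u : MvPolynomial (Fin (n + 1)) K) (hu : u.IsHomogeneous 1)
    (p : Spec (CommRingCat.of A)) :
    PushforwardStalkFreeOfRank
        ((nonvanishingLocus I (MvPolynomial.map (algebraMap K A) u)).ι ≫ projQuotToSpec I) p μ ↔
      ∀ P ∈ pointsDefinedBy (geometricFiberIdeal I p), ¬ VanishesAt u P := by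
  let q : PrimeSpectrum A := p
  let L := AlgebraicClosure q.asIdeal.ResidueField
  refine (pushforwardStalkFreeOfRank_iff I hI (hu.map (algebraMap K A)) q).trans ?_
  rw [← forall_notMem_pointIdeal_iff (eventually_finrank_geometricFiber I hI q)
    ((hu.map (algebraMap K A)).map (algebraMap A L)), ← geometricFiberIdeal_eq,
    MvPolynomial.map_map, ← IsScalarTower.algebraMap_eq K A L]
  exact forall₂_congr fun P _ => not_congr (vanishesAt_iff hu P).symm
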